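/- Let $\mathbb{F}_q$ be a finite field, $k\ge 2$, $t\ge 0$, and let $\mathcal{A}$ be an arc of $\mathrm{PG}(k-1,q)$ of size $q+k-1-t$, i.e. a set of $q+k-1-t$ points no $k$ of which are contained in a hyperplane. Order $\mathcal{A}$ arbitrarily and identify each of its points with a fixed vector representative in $\mathbb{F}_q^k$. For a $k$-tuple of variables $X=(X_1,\ldots,X_k)$, let $\Phi_t[X]$ be the space of homogeneous polynomials of degree $t$ in $X$ (including $0$) that vanish on $\mathcal{A}$. For each $(k-2)$-subset $S$ of $\mathcal{A}$ let $f_S(X)$ be a nonzero scalar multiple of the product of $t$ linear forms whose kernels are the $t$ distinct hyperplanes meeting $\mathcal{A}$ exactly in $S$. Let $E$ be the set of the first $k-2$ points of $\mathcal{A}$, and suppose the $f_S$ are scaled so that for every $S\neq E$ $$f_S(e)=(-1)^{s(t+1)}f_{(S\cup\{e\})\setminus\{a\}}(a),$$ where $e$ is the first element of $E\setminus S$, $a$ is the last element of $S\setminus E$, and $s$ is the parity of the permutation that puts the sequence consisting of $S$ (in the order of $\mathcal{A}$) followed by $e$ into the order of $\mathcal{A}$. A tensor form of $\mathcal{A}$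 is a polynomial $F(Y_1,\ldots,Y_{k-1})$ over $\mathbb{F}_q$, where each $Y_j=(Y_{j1},\ldots,Y_{jk})$ is a $k$-tuple of variables, which is homogeneous of degree $t$ in each $Y_j$ and such that, for some forms $f_S$ as above: (i) for all distinct $a_1,\ldots,a_{k-2}\in\mathcal{A}$, $F(a_1,\ldots,a_{k-2},X)\equiv(-1)^{s(t+1)}f_{\{a_1,\ldots,a_{k-2}\}}(X)$ modulo $\Phi_t[X]$, where $s$ is the parity of the permutation that puts $a_1,\ldots,a_{k-2}$ into the order of $\mathcal{A}$; (ii) $F(a_1,\ldots,a_{k-1})=0$ for every sequence $a_1,\ldots,a_{k-1}$ of points of $\mathcal{A}$ with a repeated point; (iii) for every $\sigma\in\mathrm{Sym}(k-1)$, $F(Y_{\sigma(1)},\ldots,Y_{\sigma(k-1)})\equiv(-1)^{s(t+1)}F(Y_1,\ldots,Y_{k-1})$ modulo the ideal generated by $\Phi_t[Y_1],\ldots,\Phi_t[Y_{k-1}]$, where $s$ is the parity of $\sigma$. **Theorem.** Suppose that $\mathcal{A}$ is not contained in a hypersurface of degree $t$ (i.e. no nonzero homogeneous polynomial of degree $t$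 vanishes on $\mathcal{A}$), and let $F$ be a tensor form of $\mathcal{A}$. For all exponent vectors $i_m=(i_{m1},\ldots,i_{mk})$, $1\le m\le k-2$, the coefficient (a polynomial in $X$) of $Y_1^{i_1}\cdots Y_{k-2}^{i_{k-2}}=\prod_{m,j}Y_{mj}^{i_{mj}}$ in $$F(Y_1+X,\ldots,Y_{k-2}+X,X)-F(Y_1,\ldots,Y_{k-2},X)$$ is either zero or a homogeneous polynomial in $X$ of degree $$(k-1)t-\sum_{m=1}^{k-2}\sum_{j=1}^{k} i_{mj}$$ which is zero on $\mathcal{A}$. -/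

import Mathlib

open MvPolynomial
open scoped LinearAlgebra.Projectivization

noncomputable section

namespace ArcTensor

variable {K : Type*} [Field K]

/-- A set of points of the projective space `PG(k-1, K)` is an arc if no `k` of its points are
contained in a hyperplane. -/
def IsArc {k : ℕ} (A : Set (ℙ K (Fin k → K))) : Prop :=
  ∀ s : Finset (ℙ K (Fin k → K)), (s : Set (ℙ K (Fin k → K))) ⊆ A → s.card = k →
    ∀ H : Submodule K (Fin k → K), Module.finrank K H + 1 = k → ¬ ∀ p ∈ s, p.submodule ≤ H

/-- `v` lists vector representatives of the points listed by `P`. -/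
def IsRepresentative {k N : ℕ} (P : Fin N → ℙ K (Fin k → K)) (v : Fin N → Fin k → K) : Prop :=
  ∀ i, ∃ h : v i ≠ 0, Projectivization.mk K (v i) h = P i

/-- The space `Φ_t[X]` of forms of degree `t` in `X_1, …, X_k` vanishing at all vectors `v i`. -/
def vanishingForms {k N : ℕ} (v : Fin N → Fin k → K) (t : ℕ) :
    Submodule K (MvPolynomial (Fin k) K) where
  carrier := {g | g.IsHomogeneous t ∧ ∀ i, eval (v i) g = 0}
  add_mem' := fun ha hb => ⟨ha.1.add hb.1, fun i => by simp [ha.2 i, hb.2 i]⟩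
  zero_mem' := ⟨isHomogeneous_zero _ _ _, fun i => by simp⟩
  smul_mem' := fun c g hg =>
    ⟨(homogeneousSubmodule (Fin k) K t).smul_mem c hg.1, fun i => by simp [smul_eval, hg.2 i]⟩

/-- The points represented by the `v i` are contained in a hypersurface of degree `t`, the zero
locus of a nonzero form of degree `t`. -/
def InHypersurface {k N : ℕ} (v : Fin N → Fin k → K) (t : ℕ) : Prop :=
  ∃ g : MvPolynomial (Fin k) K, g ≠ 0 ∧ g.IsHomogeneous t ∧ ∀ i, eval (v i) g = 0

/-- The linear form `∑ c_i X_i`. -/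
def linForm {k : ℕ} (c : Fin k → K) : MvPolynomial (Fin k) K := ∑ i, C (c i) * X i

/-- The kernel of the linear form `∑ c_i X_i`. -/
def linFormKer {k : ℕ} (c : Fin k → K) : Submodule K (Fin k → K) :=
  LinearMap.ker (∑ i, c i • (LinearMap.proj i : (Fin k → K) →ₗ[K] K))

/-- The tangent `S`-hyperplanes: the hyperplanes meeting the arc exactly in the points indexed
by `S`. -/
def tangentHyperplanes {k N : ℕ} (v : Fin N → Fin k → K) (S : Finset (Fin N)) :
    Set (Submodule K (Fin k → K)) :=
  {H | Module.finrank K H + 1 = k ∧ ∀ i, v i ∈ H ↔ i ∈ S}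

/-- `g` is, up to a nonzero scalar, the product of `t` linear forms whose kernels are the `t`
(distinct) tangent `S`-hyperplanes. -/
def IsTangentForm {k N : ℕ} (v : Fin N → Fin k → K) (t : ℕ) (S : Finset (Fin N))
    (g : MvPolynomial (Fin k) K) : Prop :=
  ∃ (α : Fin t → Fin k → K) (c : K), c ≠ 0 ∧
    Function.Injective (fun i => linFormKer (α i)) ∧
    Set.range (fun i => linFormKer (α i)) = tangentHyperplanes v S ∧
    g = C c * ∏ i, linForm (α i)

/-- The sign `(-1)^(s(t+1))`, where `s` is the parity of the permutation `σ`. -/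
def permSign (K : Type*) [Field K] (t : ℕ) {m : ℕ} (σ : Equiv.Perm (Fin m)) : K :=
  (((Equiv.Perm.sign σ : ℤˣ) : ℤ) : K) ^ (t + 1)

/-- The sign `(-1)^(s(t+1))`, where `s` is the parity of the permutation which puts the sequence
`w` of (indices of) points of the arc in increasing order. -/
def orderSign (K : Type*) [Field K] (t : ℕ) {m N : ℕ} (w : Fin m → Fin N) : K :=
  permSign K t (Tuple.sort w)

/-- The first `n` points of the arc. -/
def firstPoints (n N : ℕ) : Finset (Fin N) := Finset.univ.filter fun i => i.val < n

/-- The forms `f S`, for the `(k-2)`-subsets `S` of the arc (here `k = n + 2`), are tangent forms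
at `S`, scaled so that `f_S(e) = (-1)^(s(t+1)) f_{S ∪ {e} \ {a}}(a)`, where `E` consists of the
first `k-2` points, `e` is the first point of `E \ S`, `a` is the last point of `S \ E`, and `s` is
the parity of the permutation ordering the sequence consisting of `S` in increasing order followed
by `e`. -/
def IsScaledTangentSystem {n N : ℕ} (v : Fin N → Fin (n + 2) → K) (t : ℕ)
    (f : Finset (Fin N) → MvPolynomial (Fin (n + 2)) K) : Prop :=
  (∀ S : Finset (Fin N), S.card = n → IsTangentForm v t S (f S)) ∧
  ∀ (S : Finset (Fin N)) (hS : S.card = n) (e a : Fin N),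
    IsLeast (↑(firstPoints n N \ S) : Set (Fin N)) e →
    IsGreatest (↑(S \ firstPoints n N) : Set (Fin N)) a →
    eval (v e) (f S) =
      orderSign K t (Fin.snoc (S.orderEmbOfFin hS) e : Fin (n + 1) → Fin N) *
        eval (v a) (f ((insert e S).erase a))

/-- The polynomial `F(y_1, …, y_n, X)` in `X`, for vectors `y_1, …, y_n`. -/
def evalInit {n k : ℕ} (F : MvPolynomial (Fin (n + 1) × Fin k) K) (y : Fin n → Fin k → K) :
    MvPolynomial (Fin k) K :=
  aeval (fun p : Fin (n + 1) × Fin k =>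
    (Fin.snoc (fun m => C (y m p.2)) (X p.2) : Fin (n + 1) → MvPolynomial (Fin k) K) p.1) F

/-- The ideal generated by `Φ_t[Y_1], …, Φ_t[Y_m]`. -/
def vanishingIdeal {k N : ℕ} (v : Fin N → Fin k → K) (t m : ℕ) :
    Ideal (MvPolynomial (Fin m × Fin k) K) :=
  Ideal.span {G | ∃ j : Fin m, ∃ g ∈ vanishingForms v t, G = rename (fun i => (j, i)) g}

/-- `F(Y_1, …, Y_{k-1})`, with `k = n + 2`, is a tensor form of the arc with ordered list `v` of
vector representatives: it is homogeneous of degree `t` in each of the `k`-tuples of variables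
`Y_j` and has the three properties defining tensor forms. The variable `Y_{ji}` is `X (j, i)`. -/
def IsTensorForm {n N : ℕ} (v : Fin N → Fin (n + 2) → K) (t : ℕ)
    (F : MvPolynomial (Fin (n + 1) × Fin (n + 2)) K) : Prop :=
  (∀ j : Fin (n + 1), F.IsWeightedHomogeneous (fun p => if p.1 = j then 1 else 0) t) ∧
  (∃ f : Finset (Fin N) → MvPolynomial (Fin (n + 2)) K, IsScaledTangentSystem v t f ∧
    ∀ w : Fin n → Fin N, Function.Injective w →
      evalInit F (fun m => v (w m)) - C (orderSign K t w) * f (Finset.univ.image w) ∈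
        vanishingForms v t) ∧
  (∀ w : Fin (n + 1) → Fin N, ¬ Function.Injective w → eval (fun p => v (w p.1) p.2) F = 0) ∧
  ∀ σ : Equiv.Perm (Fin (n + 1)),
    rename (fun p => (σ p.1, p.2)) F - C (permSign K t σ) * F ∈ vanishingIdeal v t (n + 1)

/-- `F(Y_1, …, Y_n, X)` as a polynomial in the `Y`'s whose coefficients are polynomials in `X`. -/
def substLast {n k : ℕ} (F : MvPolynomial (Fin (n + 1) × Fin k) K) :
    MvPolynomial (Fin n × Fin k) (MvPolynomial (Fin k) K) :=
  aeval (fun p : Fin (n + 1) × Fin k =>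
    (Fin.snoc (fun m => X (m, p.2)) (C (X p.2)) :
      Fin (n + 1) → MvPolynomial (Fin n × Fin k) (MvPolynomial (Fin k) K)) p.1) F

/-- `F(Y_1 + X, …, Y_n + X, X)` as a polynomial in the `Y`'s whose coefficients are polynomials
in `X`. -/
def substShift {n k : ℕ} (F : MvPolynomial (Fin (n + 1) × Fin k) K) :
    MvPolynomial (Fin n × Fin k) (MvPolynomial (Fin k) K) :=
  aeval (fun p : Fin (n + 1) × Fin k =>
    (Fin.snoc (fun m => X (m, p.2) + C (X p.2)) (C (X p.2)) :
      Fin (n + 1) → MvPolynomial (Fin n × Fin k) (MvPolynomial (Fin k) K)) p.1) F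

end ArcTensor

end

namespace ArcTensor

/-! ### Interpolation of degree-`t` forms from the arc, and translation of tangent forms -/

section Interpolation

variable {K : Type*} [Field K] {R : Type*} [CommRing R] [Algebra K R] {k N t : ℕ}

/-! Since no nonzero form of degree `t` vanishes on the arc, the congruences defining a tensor form
are equalities, and a form of degree `t` is determined linearly by its values on the arc.

It suffices that, for each arc point `x`, `F(Y_1, …, Y_n, x)` does not change when `x` is added to
every `Y_m`: the coefficients in question then vanish at `X = x`. Shift one argument at a time. By
interpolation (`exists_interpolation_update`) all other arguments may be taken to be arc points, one
of them being `x`. Swapping the shifted argument with the last (`IsTensorForm.aeval_perm`) turns `F`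
into plus or minus a tangent form `f_S` with `x ∈ S`, or into zero if a point repeats. Every linear
factor of `f_S` vanishes at `x`, so `f_S(Z + x) = f_S(Z)`.

The degree is a count: `F` has total degree `(n + 1) t`, and both substitutions replace variables by
forms of degree 1 in the `Y`'s and `X` jointly. -/

lemma vanishingForms_eq_bot {v : Fin N → Fin k → K} (h : ¬ InHypersurface v t) :
    vanishingForms v t = ⊥ := by
  rw [eq_bot_iff]
  intro g hg
  by_contra hne
  exact h ⟨g, hne, hg.1, hg.2⟩

lemma vanishingIdeal_eq_bot {v : Fin N → Fin k → K} (h : ¬ InHypersurface v t) (m : ℕ) :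
    vanishingIdeal v t m = ⊥ := by
  rw [vanishingIdeal, Ideal.span_eq_bot]
  rintro G ⟨j, g, hg, rfl⟩
  rw [vanishingForms_eq_bot h, Submodule.mem_bot] at hg
  simp [hg]

/-- Forms of degree `t` are interpolated from their values at points which do not lie on a
hypersurface of degree `t`. -/
lemma exists_interpolation {v : Fin N → Fin k → K} (h : ¬ InHypersurface v t) (z : Fin k → R) :
    ∃ c : Fin N → R, ∀ g : MvPolynomial (Fin k) K, g.IsHomogeneous t →
      aeval z g = ∑ i, eval (v i) g • c i := by
  let ev : homogeneousSubmodule (Fin k) K t →ₗ[K] (Fin N → K) :=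
    (LinearMap.pi fun i => (aeval (v i) : MvPolynomial (Fin k) K →ₐ[K] K).toLinearMap) ∘ₗ
      Submodule.subtype _
  have hev : LinearMap.ker ev = ⊥ := by
    rw [LinearMap.ker_eq_bot']
    rintro ⟨g, hg⟩ hg0
    by_contra hne
    refine h ⟨g, fun h0 => hne (Subtype.ext h0), hg, fun i => ?_⟩
    simpa [ev, aeval_eq_eval] using congrFun hg0 i
  -- `L` recovers a form from its values on the arc. The weights are the images under `L` of the
  -- coordinate vectors, evaluated at `z`.
  obtain ⟨L, hL⟩ := ev.exists_leftInverse_of_injective hev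
  refine ⟨fun i => aeval z (L (Pi.single i 1) : MvPolynomial (Fin k) K), fun g hg => ?_⟩
  have h1 : L (ev ⟨g, hg⟩) = ⟨g, hg⟩ := LinearMap.congr_fun hL _
  have h2 : ev ⟨g, hg⟩ = ∑ i, eval (v i) g • (Pi.single i (1 : K) : Fin N → K) := by
    ext j
    simp [ev, aeval_eq_eval, Finset.sum_apply, Pi.single_apply]
  have h3 := congrArg (fun x => aeval z (Subtype.val x)) (h2 ▸ h1)
  simpa using h3.symm

lemma sum_eq_of_isWeightedHomogeneous {ι κ : Type*} [Fintype ι] [DecidableEq ι] [Fintype κ]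
    {F : MvPolynomial (ι × κ) K} {j : ι}
    (hF : F.IsWeightedHomogeneous (fun p => if p.1 = j then 1 else 0) t)
    {e : ι × κ →₀ ℕ} (he : coeff e F ≠ 0) : ∑ l, e (j, l) = t := by
  rw [← hF he, Finsupp.weight_apply, Finsupp.sum_fintype _ _ (by simp),
    Fintype.sum_prod_type, Finset.sum_eq_single j] <;> simp +contextual

/-- Interpolation in the `j`-th tuple of variables of a polynomial which is homogeneous of degree
`t` in it. -/
lemma exists_interpolation_update {ι : Type*} [Fintype ι] [DecidableEq ι]
    {v : Fin N → Fin k → K} (h : ¬ InHypersurface v t) (z : Fin k → R) :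
    ∃ c : Fin N → R, ∀ (j : ι) (F : MvPolynomial (ι × Fin k) K),
      F.IsWeightedHomogeneous (fun p => if p.1 = j then 1 else 0) t → ∀ y : ι → Fin k → R,
        aeval (fun p => Function.update y j z p.1 p.2) F =
          ∑ i, aeval (fun p => Function.update y j (fun l => algebraMap K R (v i l)) p.1 p.2) F *
            c i := by
  obtain ⟨c, hc⟩ := exists_interpolation h z
  refine ⟨c, fun j F hF y => ?_⟩
  -- Separating the `j`-th block of each monomial leaves a monomial of degree `t` in `u`, to which
  -- the interpolation formula applies.
  have split (u : Fin k → R) (e : ι × Fin k →₀ ℕ) :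
      ∏ p : ι × Fin k, Function.update y j u p.1 p.2 ^ e p =
        (∏ l, u l ^ e (j, l)) * ∏ i ∈ Finset.univ.erase j, ∏ l, y i l ^ e (i, l) := by
    rw [Fintype.prod_prod_type, ← Finset.mul_prod_erase _ _ (Finset.mem_univ j)]
    congr 1
    · simp
    · refine Finset.prod_congr rfl fun i hi => ?_
      simp [Function.update_of_ne (Finset.ne_of_mem_erase hi)]
  simp only [aeval_def, eval₂_eq']
  simp only [split, Finset.sum_mul]
  rw [Finset.sum_comm]
  refine Finset.sum_congr rfl fun e he => ?_
  have hdeg : ∑ l, e (j, l) = t := sum_eq_of_isWeightedHomogeneous hF (mem_support_iff.mp he)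
  have hmon : (∏ l, (X l : MvPolynomial (Fin k) K) ^ e (j, l)).IsHomogeneous t := by
    rw [← hdeg]
    exact IsHomogeneous.prod _ _ _ fun l _ => isHomogeneous_X_pow l _
  have hcm := hc _ hmon
  simp only [map_prod, map_pow, aeval_X, eval_X, Algebra.smul_def] at hcm
  rw [hcm]
  simp only [Finset.mul_sum, Finset.sum_mul]
  refine Finset.sum_congr rfl fun i _ => ?_
  ring

lemma aeval_linForm (α : Fin k → K) (z : Fin k → R) :
    aeval z (linForm α) = ∑ i, algebraMap K R (α i) * z i := by
  simp [linForm]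

/-- Each linear factor has a tangent hyperplane at `S` as kernel, and this contains `v i` because `i
∈ S`. -/
lemma IsTangentForm.aeval_add {v : Fin N → Fin k → K} {S : Finset (Fin N)}
    {g : MvPolynomial (Fin k) K} (hg : IsTangentForm v t S g) {i : Fin N} (hi : i ∈ S)
    (z : Fin k → R) :
    aeval (fun l => z l + algebraMap K R (v i l)) g = aeval z g := by
  obtain ⟨α, c, -, -, hα, rfl⟩ := hg
  simp only [map_mul, map_prod]
  rw [aeval_C, aeval_C]
  refine congrArg (_ * ·) (Finset.prod_congr rfl fun s _ => ?_)
  have hs : linFormKer (α s) ∈ tangentHyperplanes v S := hα ▸ Set.mem_range_self s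
  have h0 : ∑ l, α s l * v i l = 0 := by
    have := (hs.2 i).2 hi
    simpa [linFormKer] using this
  have h1 : ∑ l, algebraMap K R (α s l) * algebraMap K R (v i l) = 0 := by
    simpa using congrArg (algebraMap K R) h0
  simp only [aeval_linForm, mul_add, Finset.sum_add_distrib, h1, add_zero]

end Interpolation

/-! ### Invariance of the tensor form under translation by an arc point -/

section Shift

variable {K : Type*} [Field K] {R : Type*} [CommRing R] [Algebra K R] {n N t : ℕ}
  {v : Fin N → Fin (n + 2) → K} {F : MvPolynomial (Fin (n + 1) × Fin (n + 2)) K}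

lemma aeval_evalInit {k : ℕ} (F : MvPolynomial (Fin (n + 1) × Fin k) K) (u : Fin n → Fin k → K)
    (z : Fin k → R) :
    aeval z (evalInit F u) = aeval (fun p : Fin (n + 1) × Fin k =>
      (Fin.snoc (fun m l => algebraMap K R (u m l)) z : Fin (n + 1) → Fin k → R) p.1 p.2) F := by
  rw [evalInit, ← AlgHom.comp_apply, comp_aeval]
  congr 2
  ext ⟨j, l⟩
  refine Fin.lastCases ?_ (fun m => ?_) j <;> simp

lemma isHomogeneous_evalInit {k : ℕ} {F : MvPolynomial (Fin (n + 1) × Fin k) K}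
    (hF : F.IsWeightedHomogeneous (fun p => if p.1 = Fin.last n then 1 else 0) t)
    (u : Fin n → Fin k → K) : (evalInit F u).IsHomogeneous t := by
  rw [evalInit, aeval_def, eval₂_eq']
  refine IsHomogeneous.sum _ _ _ fun e he => ?_
  have hdeg : ∑ l, e (Fin.last n, l) = t := sum_eq_of_isWeightedHomogeneous hF (mem_support_iff.mp he)
  have hlast : (∏ l, (X l : MvPolynomial (Fin k) K) ^ e (Fin.last n, l)).IsHomogeneous t :=
    hdeg ▸ IsHomogeneous.prod _ _ _ fun l _ => isHomogeneous_X_pow l _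
  have hinit : (∏ m : Fin n, ∏ l, (C (u m l) : MvPolynomial (Fin k) K) ^
      e (m.castSucc, l)).IsHomogeneous 0 := by
    simpa only [map_prod, map_pow] using
      isHomogeneous_C (Fin k) (∏ m : Fin n, ∏ l, u m l ^ e (m.castSucc, l))
  have h := (isHomogeneous_C (Fin k) (coeff e F)).mul (hinit.mul hlast)
  rw [zero_add, zero_add] at h
  rw [Fintype.prod_prod_type, Fin.prod_univ_castSucc]
  simpa only [Fin.snoc_castSucc, Fin.snoc_last, algebraMap_eq] using h

/-- Evaluating a tensor form of an arc at arc points in all but the last argument gives a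
polynomial which is invariant under translation by these points. -/
lemma IsTensorForm.aeval_evalInit_add (hnot : ¬ InHypersurface v t) (hF : IsTensorForm v t F)
    (w : Fin n → Fin N) (m : Fin n) (z : Fin (n + 2) → R) :
    aeval (fun l => z l + algebraMap K R (v (w m) l)) (evalInit F fun m => v (w m)) =
      aeval z (evalInit F fun m => v (w m)) := by
  obtain ⟨hhom, ⟨f, hf, hFf⟩, hrep, -⟩ := hF
  by_cases hw : Function.Injective w
  · have h := hFf w hw
    rw [vanishingForms_eq_bot hnot, Submodule.mem_bot, sub_eq_zero] at h
    have hS : (Finset.univ.image w).card = n := by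
      simp [Finset.card_image_of_injective _ hw]
    rw [h, map_mul, map_mul, (hf.1 _ hS).aeval_add (by simp : w m ∈ _)]
    simp
  -- With a repeated point, property (ii) makes this degree-`t` form vanish on the whole arc, so it
  -- is zero.
  · have h : evalInit F (fun m => v (w m)) ∈ vanishingForms v t := by
      refine ⟨isHomogeneous_evalInit (hhom _) _, fun i => ?_⟩
      have h0 := hrep (Fin.snoc w i) fun hinj => hw fun a b hab => by
        have := @hinj a.castSucc b.castSucc (by simpa using hab)
        simpa using this
      rw [← aeval_eq_eval] at h0 ⊢
      rw [← h0]
      refine (aeval_evalInit F _ _).trans ?_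
      congr 2
      ext ⟨j, l⟩
      refine Fin.lastCases ?_ (fun m => ?_) j <;> simp
    rw [vanishingForms_eq_bot hnot, Submodule.mem_bot] at h
    simp [h]

lemma IsTensorForm.aeval_perm (hnot : ¬ InHypersurface v t) (hF : IsTensorForm v t F)
    (σ : Equiv.Perm (Fin (n + 1))) (y : Fin (n + 1) → Fin (n + 2) → R) :
    aeval (fun p => y (σ p.1) p.2) F =
      algebraMap K R (permSign K t σ) * aeval (fun p => y p.1 p.2) F := by
  have h := hF.2.2.2 σ
  rw [vanishingIdeal_eq_bot hnot, Ideal.mem_bot, sub_eq_zero] at h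
  have h1 := congrArg (aeval fun p : Fin (n + 1) × Fin (n + 2) => y p.1 p.2) h
  rw [aeval_rename, map_mul, aeval_C] at h1
  exact h1

lemma permSign_mul_self (σ : Equiv.Perm (Fin n)) :
    permSign K t σ * permSign K t σ = 1 := by
  rw [permSign, ← mul_pow]
  rcases Int.units_eq_one_or (Equiv.Perm.sign σ) with h | h <;> simp [h]

/-- Translation invariance in one argument when all other arguments are arc points. -/
lemma IsTensorForm.aeval_update_add_of_forall (hnot : ¬ InHypersurface v t)
    (hF : IsTensorForm v t F) {m : Fin (n + 1)} (hm : m ≠ Fin.last n) (i : Fin N)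
    (y : Fin (n + 1) → Fin (n + 2) → R)
    (hlast : y (Fin.last n) = fun l => algebraMap K R (v i l))
    (hy : ∀ j ≠ m, ∃ s : Fin N, y j = fun l => algebraMap K R (v s l)) :
    aeval (fun p => Function.update y m (fun l => y m l + algebraMap K R (v i l)) p.1 p.2) F =
      aeval (fun p => y p.1 p.2) F := by
  set σ := Equiv.swap m (Fin.last n) with hσ
  have hperm (x : Fin (n + 1) → Fin (n + 2) → R) : aeval (fun p => x p.1 p.2) F =
      algebraMap K R (permSign K t σ) * aeval (fun p => x (σ p.1) p.2) F := by
    rw [hF.aeval_perm hnot σ x, ← mul_assoc, ← map_mul, permSign_mul_self, map_one, one_mul]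
  have hne (a : Fin n) : σ a.castSucc ≠ m := by
    intro h
    have := σ.injective (h.trans (Equiv.swap_apply_right m (Fin.last n)).symm)
    exact (Fin.castSucc_lt_last a).ne this
  choose w hw using fun a : Fin n => hy (σ a.castSucc) (hne a)
  obtain ⟨a, rfl⟩ := Fin.exists_castSucc_eq.mpr hm
  have key (z : Fin (n + 2) → R) :
      aeval (fun p => Function.update y a.castSucc z (σ p.1) p.2) F =
        aeval z (evalInit F fun b => v (w b)) := by
    rw [aeval_evalInit]
    congr 2
    ext ⟨j, l⟩
    refine Fin.lastCases ?_ (fun b => ?_) j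
    · simp [hσ]
    · simp [Function.update_of_ne (hne b), hw b]
  -- After the swap, the last argument `v i` sits in slot `a`. Only the vectors are compared, as `w
  -- a` and `i` need not be known to be the same index.
  have hwa : (fun l => algebraMap K R (v (w a) l)) = fun l => algebraMap K R (v i l) := by
    rw [← hw a, ← hlast, hσ, Equiv.swap_apply_left]
  have hinv := hF.aeval_evalInit_add hnot w a (y a.castSucc)
  have hwa' (l) : algebraMap K R (v (w a) l) = algebraMap K R (v i l) := congrFun hwa l
  simp only [hwa'] at hinv
  rw [hperm, key, hinv, ← key, Function.update_eq_self, ← hperm]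

lemma IsTensorForm.aeval_update_add (hnot : ¬ InHypersurface v t)
    (hF : IsTensorForm v t F) {m : Fin (n + 1)} (hm : m ≠ Fin.last n) (i : Fin N)
    (y : Fin (n + 1) → Fin (n + 2) → R)
    (hlast : y (Fin.last n) = fun l => algebraMap K R (v i l)) :
    aeval (fun p => Function.update y m (fun l => y m l + algebraMap K R (v i l)) p.1 p.2) F =
      aeval (fun p => y p.1 p.2) F := by
  -- `s` contains the slots, other than `m`, whose arguments may be arbitrary; the induction frees
  -- them one by one.
  suffices H : ∀ s : Finset (Fin (n + 1)), ∀ y : Fin (n + 1) → Fin (n + 2) → R,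
      y (Fin.last n) = (fun l => algebraMap K R (v i l)) →
      (∀ j ∉ s, j ≠ m → ∃ s : Fin N, y j = fun l => algebraMap K R (v s l)) →
      aeval (fun p => Function.update y m (fun l => y m l + algebraMap K R (v i l)) p.1 p.2) F =
        aeval (fun p => y p.1 p.2) F from
    H Finset.univ y hlast fun j hj => absurd (Finset.mem_univ j) hj
  intro s
  induction s using Finset.induction_on with
  | empty =>
    intro y hlast hy
    exact hF.aeval_update_add_of_forall hnot hm i y hlast fun j hj => hy j (by simp) hj
  | insert j s _ ih =>
    intro y hlast hy
    by_cases hjm : j = m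
    · exact ih y hlast fun l hl hlm => hy l (by simp [hl, hlm, hjm]) hlm
    by_cases hjl : j = Fin.last n
    · refine ih y hlast fun l hl hlm => ?_
      by_cases hlj : l = j
      · exact ⟨i, by rw [hlj, hjl, hlast]⟩
      · exact hy l (by simp [hl, hlj]) hlm
    -- The weights depend only on `y j`, so the shifted and unshifted sides expand with the same `c`
    -- and can be compared term by term.
    obtain ⟨c, hc⟩ := exists_interpolation_update (ι := Fin (n + 1)) hnot (y j)
    have h1 := hc j F (hF.1 j) y
    have h2 := hc j F (hF.1 j)
      (Function.update y m (fun l => y m l + algebraMap K R (v i l)))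
    rw [Function.update_eq_self] at h1
    rw [Function.update_comm (Ne.symm hjm), Function.update_eq_self] at h2
    rw [h1, h2]
    refine Finset.sum_congr rfl fun a _ => ?_
    congr 1
    have h3 := ih (Function.update y j fun l => algebraMap K R (v a l))
      (by rw [Function.update_of_ne (Ne.symm hjl), hlast]) fun l hl hlm => by
        by_cases hlj : l = j
        · exact ⟨a, by rw [hlj, Function.update_self]⟩
        · rw [Function.update_of_ne hlj]
          exact hy l (by simp [hl, hlj]) hlm
    rw [Function.update_of_ne (Ne.symm hjm)] at h3
    rw [← h3, Function.update_comm hjm]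

/-- A tensor form with an arc point as last argument is invariant under translation of all other
arguments by this point. -/
lemma IsTensorForm.aeval_snoc_add (hnot : ¬ InHypersurface v t)
    (hF : IsTensorForm v t F) (i : Fin N) (y : Fin n → Fin (n + 2) → R) :
    aeval (fun p : Fin (n + 1) × Fin (n + 2) =>
      (Fin.snoc (fun m l => y m l + algebraMap K R (v i l)) (fun l => algebraMap K R (v i l)) :
        Fin (n + 1) → Fin (n + 2) → R) p.1 p.2) F =
    aeval (fun p : Fin (n + 1) × Fin (n + 2) =>
      (Fin.snoc y (fun l => algebraMap K R (v i l)) :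
        Fin (n + 1) → Fin (n + 2) → R) p.1 p.2) F := by
  -- `s` is the set of arguments already translated.
  suffices H : ∀ s : Finset (Fin n), aeval (fun p : Fin (n + 1) × Fin (n + 2) =>
      (Fin.snoc (fun m l => if m ∈ s then y m l + algebraMap K R (v i l) else y m l)
        (fun l => algebraMap K R (v i l)) : Fin (n + 1) → Fin (n + 2) → R) p.1 p.2) F =
      aeval (fun p : Fin (n + 1) × Fin (n + 2) =>
        (Fin.snoc y (fun l => algebraMap K R (v i l)) :
          Fin (n + 1) → Fin (n + 2) → R) p.1 p.2) F by
    simpa using H Finset.univ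
  intro s
  induction s using Finset.induction_on with
  | empty => simp
  | insert m s hms ih =>
    refine Eq.trans ?_ ((hF.aeval_update_add hnot (Fin.castSucc_lt_last m).ne i _
      (by simp)).trans ih)
    congr 2
    ext ⟨j, l⟩
    dsimp only
    rw [← Fin.snoc_update]
    refine Fin.lastCases ?_ (fun b => ?_) j
    · simp
    · by_cases hb : b = m
      · subst hb
        simp [hms]
      · simp [hb]

end Shift

/-! ### Joint degree in the `Y`'s and `X` -/

section Degree

variable {K : Type*} [Field K] {σ τ : Type*}

/-- A polynomial with polynomial coefficients is homogeneous of degree `s` in all its variables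
together. -/
def IsJointlyHomogeneous (Q : MvPolynomial σ (MvPolynomial τ K)) (s : ℕ) : Prop :=
  ∀ d e, coeff e (coeff d Q) ≠ 0 → d.degree + e.degree = s

namespace IsJointlyHomogeneous

variable {Q Q' : MvPolynomial σ (MvPolynomial τ K)} {s s' : ℕ}

lemma add (h : IsJointlyHomogeneous Q s) (h' : IsJointlyHomogeneous Q' s) :
    IsJointlyHomogeneous (Q + Q') s := by
  intro d e hde
  by_cases h0 : coeff e (coeff d Q) = 0
  · exact h' d e fun h1 => hde (by simp [h0, h1])
  · exact h d e h0

lemma neg (h : IsJointlyHomogeneous Q s) : IsJointlyHomogeneous (-Q) s :=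
  fun d e hde => h d e fun h0 => hde (by simp [h0])

lemma sum {ι : Type*} {u : Finset ι} {Q : ι → MvPolynomial σ (MvPolynomial τ K)}
    (h : ∀ i ∈ u, IsJointlyHomogeneous (Q i) s) : IsJointlyHomogeneous (∑ i ∈ u, Q i) s := by
  intro d e hde
  rw [coeff_sum, coeff_sum] at hde
  obtain ⟨i, hi, hne⟩ := Finset.exists_ne_zero_of_sum_ne_zero hde
  exact h i hi d e hne

lemma mul (h : IsJointlyHomogeneous Q s) (h' : IsJointlyHomogeneous Q' s') :
    IsJointlyHomogeneous (Q * Q') (s + s') := by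
  classical
  intro d e hde
  rw [coeff_mul, coeff_sum] at hde
  obtain ⟨a, ha, hne⟩ := Finset.exists_ne_zero_of_sum_ne_zero hde
  rw [coeff_mul] at hne
  obtain ⟨b, hb, hne⟩ := Finset.exists_ne_zero_of_sum_ne_zero hne
  rw [Finset.HasAntidiagonal.mem_antidiagonal] at ha hb
  rw [← ha, ← hb, ← h _ _ (left_ne_zero_of_mul hne), ← h' _ _ (right_ne_zero_of_mul hne)]
  simp only [map_add]
  ring

lemma C_C (c : K) : IsJointlyHomogeneous (C (C c) : MvPolynomial σ (MvPolynomial τ K)) 0 := by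
  classical
  intro d e hde
  rw [coeff_C] at hde
  split_ifs at hde with hd
  · rw [coeff_C] at hde
    split_ifs at hde with he
    · simp [← hd, ← he]
    · exact absurd rfl hde
  · exact absurd (coeff_zero e) hde

lemma X (i : σ) : IsJointlyHomogeneous (X i : MvPolynomial σ (MvPolynomial τ K)) 1 := by
  classical
  intro d e hde
  rw [coeff_X] at hde
  split_ifs at hde with hd
  · rw [coeff_one] at hde
    split_ifs at hde with he
    · simp [← hd, ← he]
    · exact absurd rfl hde
  · exact absurd (coeff_zero e) hde

lemma C_X (i : τ) : IsJointlyHomogeneous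
    (C (MvPolynomial.X i) : MvPolynomial σ (MvPolynomial τ K)) 1 := by
  classical
  intro d e hde
  rw [coeff_C] at hde
  split_ifs at hde with hd
  · rw [coeff_X] at hde
    split_ifs at hde with he
    · simp [← hd, ← he]
    · exact absurd rfl hde
  · exact absurd (coeff_zero e) hde

lemma pow (h : IsJointlyHomogeneous Q s) (m : ℕ) : IsJointlyHomogeneous (Q ^ m) (m * s) := by
  induction m with
  | zero => simpa using C_C (σ := σ) (τ := τ) (1 : K)
  | succ m ih => simpa [pow_succ, add_mul] using ih.mul h

lemma prod {ι : Type*} {u : Finset ι} {Q : ι → MvPolynomial σ (MvPolynomial τ K)} {s : ι → ℕ}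
    (h : ∀ i ∈ u, IsJointlyHomogeneous (Q i) (s i)) :
    IsJointlyHomogeneous (∏ i ∈ u, Q i) (∑ i ∈ u, s i) := by
  classical
  induction u using Finset.induction_on with
  | empty => simpa using C_C (σ := σ) (τ := τ) (1 : K)
  | insert a u ha ih =>
    rw [Finset.prod_insert ha, Finset.sum_insert ha]
    exact (h a (by simp)).mul (ih fun i hi => h i (by simp [hi]))

lemma aeval {ρ : Type*} [Fintype ρ] {F : MvPolynomial ρ K} (hF : F.IsHomogeneous s)
    {y : ρ → MvPolynomial σ (MvPolynomial τ K)} (hy : ∀ i, IsJointlyHomogeneous (y i) 1) :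
    IsJointlyHomogeneous (MvPolynomial.aeval y F) s := by
  rw [aeval_def, eval₂_eq']
  refine sum fun e he => ?_
  have hdeg : ∑ i, e i * 1 = s := by
    have h := hF (mem_support_iff.mp he)
    rw [Finsupp.weight_apply, Finsupp.sum_fintype _ _ (by simp)] at h
    simpa using h
  have h := (C_C (σ := σ) (τ := τ) (coeff e F)).mul
    (prod (u := Finset.univ) fun i _ => (hy i).pow (e i))
  rwa [hdeg, zero_add] at h

lemma coeff_eq_zero_or (h : IsJointlyHomogeneous Q s) (d : σ →₀ ℕ) :
    coeff d Q = 0 ∨ ∃ r, r + d.degree = s ∧ (coeff d Q).IsHomogeneous r := by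
  by_cases h0 : coeff d Q = 0
  · exact Or.inl h0
  obtain ⟨e, he⟩ := ne_zero_iff.mp h0
  -- The degree is read off from a monomial that occurs, which avoids truncated subtraction in `s -
  -- d.degree`.
  refine Or.inr ⟨e.degree, by rw [add_comm]; exact h d e he, fun e' he' => ?_⟩
  have h1 := h d e he
  have h2 := h d e' he'
  have h3 : Finsupp.weight 1 e' = e'.degree := by rw [Finsupp.degree_eq_weight_one]; rfl
  omega

end IsJointlyHomogeneous

lemma isHomogeneous_of_forall_isWeightedHomogeneous {ι κ : Type*} [Fintype ι] [DecidableEq ι]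
    [Fintype κ] {t : ℕ} {F : MvPolynomial (ι × κ) K}
    (hF : ∀ j, F.IsWeightedHomogeneous (fun p => if p.1 = j then 1 else 0) t) :
    F.IsHomogeneous (Fintype.card ι * t) := by
  intro e he
  have h (j : ι) : ∑ l, e (j, l) = t := sum_eq_of_isWeightedHomogeneous (hF j) he
  rw [Finsupp.weight_apply, Finsupp.sum_fintype _ _ (by simp), Fintype.sum_prod_type]
  simp [h]

end Degree

/-! ### Specialising `X` to a point in the two substitutions -/

section Substitution

variable {K : Type*} [Field K] {n k : ℕ}

lemma map_eval_aeval {σ τ ρ : Type*} (F : MvPolynomial ρ K)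
    (y : ρ → MvPolynomial σ (MvPolynomial τ K)) (x : τ → K) :
    map (eval x) (aeval y F) = aeval (fun p => map (eval x) (y p)) F := by
  induction F using MvPolynomial.induction_on with
  | C a => simp [MvPolynomial.algebraMap_apply]
  | add p q hp hq => simp [hp, hq]
  | mul_X p i hp => simp [hp]

lemma map_eval_substLast (F : MvPolynomial (Fin (n + 1) × Fin k) K) (x : Fin k → K) :
    map (eval x) (substLast F) = aeval (fun p : Fin (n + 1) × Fin k =>
      (Fin.snoc (fun m l => X (m, l)) (fun l => algebraMap K _ (x l)) :
        Fin (n + 1) → Fin k → MvPolynomial (Fin n × Fin k) K) p.1 p.2) F := by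
  rw [substLast, map_eval_aeval]
  congr 2
  ext1 ⟨j, l⟩
  refine Fin.lastCases ?_ (fun m => ?_) j <;> simp [algebraMap_eq]

lemma map_eval_substShift (F : MvPolynomial (Fin (n + 1) × Fin k) K) (x : Fin k → K) :
    map (eval x) (substShift F) = aeval (fun p : Fin (n + 1) × Fin k =>
      (Fin.snoc (fun m l => X (m, l) + algebraMap K _ (x l)) (fun l => algebraMap K _ (x l)) :
        Fin (n + 1) → Fin k → MvPolynomial (Fin n × Fin k) K) p.1 p.2) F := by
  rw [substShift, map_eval_aeval]
  congr 2
  ext1 ⟨j, l⟩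
  refine Fin.lastCases ?_ (fun m => ?_) j <;> simp [algebraMap_eq]

lemma isJointlyHomogeneous_substShift_sub_substLast {s : ℕ}
    {F : MvPolynomial (Fin (n + 1) × Fin k) K} (hF : F.IsHomogeneous s) :
    IsJointlyHomogeneous (substShift F - substLast F) s := by
  rw [sub_eq_add_neg]
  refine IsJointlyHomogeneous.add (.aeval hF ?_) (IsJointlyHomogeneous.neg (.aeval hF ?_))
  all_goals
    rintro ⟨j, l⟩
    refine Fin.lastCases ?_ (fun m => ?_) j
  · simpa using .C_X l
  · simpa using (IsJointlyHomogeneous.X (m, l)).add (.C_X l)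
  · simpa using .C_X l
  · simpa using IsJointlyHomogeneous.X (m, l)

end Substitution

end ArcTensor

/-- Here `k = n + 2 ≥ 2`, the field `K` has `q` elements, and the arc has size `N = q + k - 1 - t`. -/
theorem mainTheorem5 {K : Type*} [Field K] [Fintype K] (n t N : ℕ)
    (P : Fin N → ℙ K (Fin (n + 2) → K)) (hP : Function.Injective P)
    (hArc : ArcTensor.IsArc (Set.range P))
    (hN : N + t = Fintype.card K + (n + 1))
    (v : Fin N → Fin (n + 2) → K) (hv : ArcTensor.IsRepresentative P v)
    (hnot : ¬ ArcTensor.InHypersurface v t)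
    (F : MvPolynomial (Fin (n + 1) × Fin (n + 2)) K) (hF : ArcTensor.IsTensorForm v t F)
    (d : Fin n × Fin (n + 2) →₀ ℕ) :
    coeff d (ArcTensor.substShift F - ArcTensor.substLast F) = 0 ∨
      ∃ r : ℕ, r + ∑ m : Fin n, ∑ j : Fin (n + 2), d (m, j) = (n + 1) * t ∧
        (coeff d (ArcTensor.substShift F - ArcTensor.substLast F)).IsHomogeneous r ∧
        ∀ i, eval (v i) (coeff d (ArcTensor.substShift F - ArcTensor.substLast F)) = 0 := by
  have hzero (i : Fin N) :
      eval (v i) (coeff d (ArcTensor.substShift F - ArcTensor.substLast F)) = 0 := by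
    -- Setting `X = v i` commutes with taking coefficients in the `Y`'s. Invariance is then used
    -- over the algebra of polynomials in the `Y`'s, with the variables themselves as arguments: an
    -- identity of polynomials, not only of values over the finite field.
    rw [← coeff_map, map_sub, ArcTensor.map_eval_substShift, ArcTensor.map_eval_substLast,
      hF.aeval_snoc_add hnot i (fun m l => X (m, l)), sub_self, coeff_zero]
  have hhom : F.IsHomogeneous ((n + 1) * t) := by
    simpa using ArcTensor.isHomogeneous_of_forall_isWeightedHomogeneous hF.1
  refine ((ArcTensor.isJointlyHomogeneous_substShift_sub_substLast hhom).coeff_eq_zero_or d).imp_right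
    fun ⟨r, hr, h⟩ => ⟨r, ?_, h, hzero⟩
  rw [← hr, Finsupp.degree_eq_sum, Fintype.sum_prod_type]
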